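/- Let $V$ be a valuation ring (an integral domain such that for every nonzero $x$ in its fraction field $K$ we have $x\in V$ or $x^{-1}\in V$; the case $V=K$ is allowed), with valuation $v$ on $K$ and (additive, totally ordered) value group $\Gamma$. Say that an integral domain is N-2 if its integral closure in every finite extension of its fraction field is finite as a module over it. For a finite field extension $L/K$, let $w_1,\dots,w_g$ be the finitely many extensions of $v$ to $L$ (up to equivalence), and let $e(w_i/v)=[\Gamma_{w_i}:\Gamma]$ and $f(w_i/v)=[k_{w_i}:k_v]$ be the index of value groups and the degree of residue fields. Say that $V$ is defectless if $[L:K]=\sum_{i=1}^g e(w_i/v)f(w_i/v)$ for every finite extension $L/K$. Then $V$ is N-2 if and only if the following two conditions hold. (i) $V$ is defectless. (ii) Either $\Gamma$ is divisible, or $\Gamma$ has a smallest positive element $\epsilon$ and $\Gamma/\mathbf{Z}\epsilon$ is divisible (the case $\Gamma/\mathbf{Z}\epsilon=0$ is allowed). -/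

import Mathlib

universe u

/-- An integral domain `S` is N-2 (Japanese) if its integral closure in every finite extension `L`
of its fraction field is a finite `S`-module. -/
def IsN2 (S : Type u) [CommRing S] [IsDomain S] : Prop :=
  ∀ (L : Type u) [Field L] [Algebra S L] [Algebra (FractionRing S) L]
    [IsScalarTower S (FractionRing S) L] [FiniteDimensional (FractionRing S) L],
    Module.Finite S (integralClosure S L)

namespace ValRing

/-- The value group of a valuation ring `V`, written additively and ordered as is usual for
additive valuations: `ValuationRing.ValueGroup` is the multiplicative value group with zero, in
which elements of `V` have value `≤ 1`, so the zero is removed and the order is reversed. -/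
abbrev AddValueGroup (V : Type*) [CommRing V] [IsDomain V] [ValuationRing V] : Type _ :=
  (Additive (ValuationRing.ValueGroup V (FractionRing V))ˣ)ᵒᵈ

/-- The extensions to `L` of the valuation of `V` on its fraction field `K`, up to equivalence:
an equivalence class of valuations is given by its valuation ring, and a valuation ring `W` of `L`
belongs to an extension precisely if `W ∩ K = V`. -/
def Extension (V K L : Type*) [CommRing V] [Field K] [Algebra V K] [Field L] [Algebra K L] :
    Type _ :=
  {W : ValuationSubring L // ∀ x : K, algebraMap K L x ∈ W ↔ x ∈ (algebraMap V K).range}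

namespace Extension

variable {V K L : Type*} [CommRing V] [Field K] [Algebra V K] [Field L] [Algebra K L]

/-- The image in the value group of `W` of the value group of `V`: the values of the nonzero
elements of `K`. -/
noncomputable def baseValues (W : Extension V K L) : Subgroup (W.1.ValueGroup)ˣ :=
  (Units.map
    ((W.1.valuation.comap (algebraMap K L)).toMonoidWithZeroHom : K →* W.1.ValueGroup)).range

/-- The ramification index `e = [Γ_w : Γ_v]`. -/
noncomputable def ramificationIndex (W : Extension V K L) : ℕ :=
  W.baseValues.index

/-- The inclusion of `V` in `W`. -/
def inclusion (W : Extension V K L) : V →+* W.1 :=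
  ((algebraMap K L).comp (algebraMap V K)).codRestrict W.1
    fun a => (W.2 (algebraMap V K a)).2 ⟨a, rfl⟩

instance isLocalHom_inclusion [IsDomain V] [IsFractionRing V K] (W : Extension V K L) :
    IsLocalHom W.inclusion where
  map_nonunit a ha := by
    obtain ⟨u, hu⟩ := ha
    have hau : algebraMap K L (algebraMap V K a) * ((u⁻¹ : (W.1)ˣ) : W.1) = 1 := by
      have h : W.inclusion a * ((u⁻¹ : (W.1)ˣ) : W.1) = 1 := by rw [← hu, Units.mul_inv]
      exact congrArg Subtype.val h
    have hinv : algebraMap K L (algebraMap V K a)⁻¹ = ((u⁻¹ : (W.1)ˣ) : W.1) := by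
      rw [map_inv₀]
      exact (eq_inv_of_mul_eq_one_right hau).symm
    obtain ⟨b, hb⟩ := (W.2 (algebraMap V K a)⁻¹).1 (hinv ▸ Subtype.property _)
    have ha0 : algebraMap V K a ≠ 0 := by
      intro h0
      rw [h0, map_zero, zero_mul] at hau
      exact zero_ne_one hau
    refine IsUnit.of_mul_eq_one b (IsFractionRing.injective V K ?_)
    rw [map_mul, hb, map_one, mul_inv_cancel₀ ha0]

/-- The inertia degree `f = [k_w : k_v]`, the degree of the extension of residue fields. -/
noncomputable def inertiaDegree [IsDomain V] [ValuationRing V] [IsFractionRing V K]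
    (W : Extension V K L) : ℕ :=
  letI : Algebra (IsLocalRing.ResidueField V) (IsLocalRing.ResidueField W.1) :=
    (IsLocalRing.ResidueField.map W.inclusion).toAlgebra
  Module.finrank (IsLocalRing.ResidueField V) (IsLocalRing.ResidueField W.1)

end Extension

/-- A finite extension `L` of the fraction field `K` of `V` is defectless if equality holds in the
fundamental inequality `[L : K] ≥ ∑ e(w/v) f(w/v)`, the sum running over the extensions `w` to `L`
of the valuation `v` of `V`. By the fundamental inequality itself, the number of the extensions,
the indices `e` and the degrees `f` are finite for every finite extension `L`, so that the sum and
its terms take their genuine values here. -/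
def IsDefectlessExtension (V K L : Type*) [CommRing V] [IsDomain V] [ValuationRing V] [Field K]
    [Algebra V K] [IsFractionRing V K] [Field L] [Algebra K L] : Prop :=
  Module.finrank K L = ∑ᶠ W : Extension V K L, W.ramificationIndex * W.inertiaDegree

/-- A valuation ring is defectless if every finite extension of its fraction field is. -/
def IsDefectless (V : Type u) [CommRing V] [IsDomain V] [ValuationRing V] : Prop :=
  ∀ (L : Type u) [Field L] [Algebra (FractionRing V) L] [FiniteDimensional (FractionRing V) L],
    IsDefectlessExtension V (FractionRing V) L

end ValRing

/-! Let `m` be the maximal ideal of `V` and `B` its integral closure in `L`. Everything is read off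
from `B/mB`. Lifts to `B` of a `V/m`-basis of `B/mB` stay independent over `K`: divide a relation by
its dominant coefficient and reduce. So `dim B/mB ≤ [L:K]`, and equality holds exactly when `B` is
finite over `V` (`finite_integralClosure_iff`). The artinian ring `B/mB` is the product of its
localizations. Its primes correspond to the extensions `W`, with local factors `W/mW`, so `dim B/mB`
is the sum of the lengths of the `W/mW` (`finrank_reducedClosure`). Under (ii) each length equals `e
* f`: for divisible `Γ`, `mW` is the maximal ideal and `e = 1`; in the other case both maximal
ideals are principal and `π` is a unit times `ϖ ^ e`. Given (ii), defectlessness of `L` is therefore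
the same as finiteness of `B`. It remains to derive (ii) from N-2. Adjoin an `n`-th root `α` of `x`.
If `B` is finite, it is free, and the `c` in `K` with `c • α` integral form a principal fractional
ideal. Hence there is a largest `δ` with `n • δ ≤ v(x)`, and such maxima for all `n` and `x` force
(ii) (`divisible_or_of_exists_max`). -/

open IsLocalRing

attribute [local instance] Ideal.Quotient.field

set_option linter.unusedSectionVars false

/-! ### Reduction of the integral closure modulo the maximal ideal -/

namespace ValRing

section ReductionOfIntegralClosure

variable {V K L : Type*} [CommRing V] [IsDomain V] [ValuationRing V] [Field K]
  [Algebra V K] [IsFractionRing V K] [Field L] [Algebra K L] [Algebra V L] [IsScalarTower V K L]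

theorem valuation_le_one_iff_mem_range (x : K) :
    ValuationRing.valuation V K x ≤ 1 ↔ x ∈ (algebraMap V K).range := by
  rw [← Valuation.mem_integer_iff, ValuationRing.mem_integer_iff]
  rfl

theorem mem_maximalIdeal_of_inv_notMem_range {x : K} (hx : x ≠ 0)
    (h : x ∉ (algebraMap V K).range) : ∃ a ∈ maximalIdeal V, algebraMap V K a = x⁻¹ := by
  obtain ⟨a, ha⟩ : x⁻¹ ∈ (algebraMap V K).range := by
    rw [← valuation_le_one_iff_mem_range, map_inv₀]
    rw [← valuation_le_one_iff_mem_range, not_le] at h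
    exact inv_le_one_of_one_le₀ h.le
  refine ⟨a, fun hu => h ?_, ha⟩
  obtain ⟨b, hb⟩ := hu.exists_right_inv
  refine ⟨b, ?_⟩
  have := congrArg (algebraMap V K) hb
  rw [map_mul, ha, map_one] at this
  field_simp at this
  exact this

variable (V L) in
/-- The reduction of the integral closure of `V` in `L` modulo the maximal ideal of `V`. -/
abbrev ReducedClosure : Type _ :=
  integralClosure V L ⧸ (maximalIdeal V).map (algebraMap V (integralClosure V L))

/-- Division by a coefficient of largest valuation gives a combination over `V` with one coefficient
equal to 1; if it lay in `mB`, its reduction would be a nontrivial relation. The case `y = 0` yields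
independence over `K`, general `y` yields integrality of coefficients. -/
theorem exists_dominant_coeff {ι : Type*} {b : ι → integralClosure V L}
    (hb : LinearIndependent (V ⧸ maximalIdeal V)
      (fun i => (Ideal.Quotient.mk _ (b i) : ReducedClosure V L)))
    (s : Finset ι) (c : ι → K) {i : ι} (hi : i ∈ s) (hci : c i ≠ 0) :
    ∃ j ∈ s, c j ≠ 0 ∧
      (∀ i ∈ s, ValuationRing.valuation V K (c i) ≤ ValuationRing.valuation V K (c j)) ∧
      ∀ y ∈ (maximalIdeal V).map (algebraMap V (integralClosure V L)),
        ∑ i ∈ s, c i • (b i : L) ≠ c j • (y : L) := by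
  obtain ⟨j, hj, hmax⟩ := s.exists_max_image (fun i => ValuationRing.valuation V K (c i)) ⟨i, hi⟩
  have hcj : c j ≠ 0 := by
    rintro h0
    have := hmax i hi
    rw [h0, map_zero, le_zero_iff, map_eq_zero] at this
    exact hci this
  refine ⟨j, hj, hcj, hmax, fun y hy heq => ?_⟩
  have hex : ∀ i, ∃ a : V, i ∈ s → algebraMap V K a = c i / c j := by
    intro i
    by_cases his : i ∈ s
    · obtain ⟨a, ha⟩ : c i / c j ∈ (algebraMap V K).range := by
        rw [← valuation_le_one_iff_mem_range, map_div₀]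
        exact div_le_one_of_le₀ (hmax i his) zero_le
      exact ⟨a, fun _ => ha⟩
    · exact ⟨0, fun h => (his h).elim⟩
  choose a ha using hex
  have hsum : ∑ i ∈ s, a i • b i = y := by
    apply Subtype.ext
    rw [AddSubmonoidClass.coe_finsetSum]
    have : ∀ i ∈ s, ((a i • b i : integralClosure V L) : L) = (c j)⁻¹ • (c i • (b i : L)) := by
      intro i hi
      rw [Subalgebra.coe_smul, ← IsScalarTower.algebraMap_smul K (a i) (b i : L), ha i hi,
        smul_smul, div_eq_inv_mul]
    rw [Finset.sum_congr rfl this, ← Finset.smul_sum, heq, smul_smul, inv_mul_cancel₀ hcj,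
      one_smul]
  have h0 : ∑ i ∈ s, (Ideal.Quotient.mk (maximalIdeal V) (a i)) •
      (Ideal.Quotient.mk _ (b i) : ReducedClosure V L) = 0 := by
    rw [← Ideal.Quotient.eq_zero_iff_mem, ← hsum, map_sum] at hy
    rw [← hy]
    refine Finset.sum_congr rfl fun i _ => ?_
    rw [Algebra.smul_def, Algebra.smul_def, map_mul]
    rfl
  have := linearIndependent_iff'.1 hb s _ h0 j hj
  have h1 : a j = 1 := IsFractionRing.injective V K (by rw [ha j hj, div_self hcj, map_one])
  rw [h1, map_one] at this
  exact one_ne_zero this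

/-- If some coefficient is outside `V`, so is the dominant one `c j`; then `(c j)⁻¹` lies in `m` and
`z = c j • ((c j)⁻¹ • z)` contradicts `exists_dominant_coeff`. -/
theorem coeff_mem_range {ι : Type*} {b : ι → integralClosure V L}
    (hb : LinearIndependent (V ⧸ maximalIdeal V)
      (fun i => (Ideal.Quotient.mk _ (b i) : ReducedClosure V L)))
    (s : Finset ι) (c : ι → K) (z : integralClosure V L)
    (hz : ∑ i ∈ s, c i • (b i : L) = z) {i : ι} (hi : i ∈ s) : c i ∈ (algebraMap V K).range := by
  by_contra hci
  have hci0 : c i ≠ 0 := fun h => hci (h ▸ zero_mem _)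
  obtain ⟨j, hj, hcj, hmax, hne⟩ := exists_dominant_coeff hb s c hi hci0
  have hcj' : c j ∉ (algebraMap V K).range := by
    rw [← valuation_le_one_iff_mem_range] at hci ⊢
    exact fun h => hci ((hmax i hi).trans h)
  obtain ⟨a, ham, ha⟩ := mem_maximalIdeal_of_inv_notMem_range hcj hcj'
  refine hne (algebraMap V _ a * z)
    (Ideal.mul_mem_right _ _ (Ideal.mem_map_of_mem _ ham)) ?_
  have : ((algebraMap V (integralClosure V L) a * z : integralClosure V L) : L)
      = (c j)⁻¹ • (z : L) := by
    rw [← Algebra.smul_def, Subalgebra.coe_smul, ← IsScalarTower.algebraMap_smul K a (z : L), ha]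
  rw [hz, this, smul_smul, mul_inv_cancel₀ hcj, one_smul]

theorem linearIndependent_of_reduction {ι : Type*} {b : ι → integralClosure V L}
    (hb : LinearIndependent (V ⧸ maximalIdeal V)
      (fun i => (Ideal.Quotient.mk _ (b i) : ReducedClosure V L))) :
    LinearIndependent K (fun i => (b i : L)) := by
  rw [linearIndependent_iff']
  intro s c hc i hi
  by_contra hci
  obtain ⟨j, -, -, -, hne⟩ := exists_dominant_coeff hb s c hi hci
  exact hne 0 (zero_mem _) (by rw [hc, ZeroMemClass.coe_zero, smul_zero])

set_option synthInstance.maxHeartbeats 200000 in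
variable (V) in
theorem exists_lift_basis (L : Type u) [Field L] [Algebra V L] :
    ∃ (ι : Type u) (b : ι → integralClosure V L)
      (B : Module.Basis ι (V ⧸ maximalIdeal V) (ReducedClosure V L)),
      ∀ i, B i = Ideal.Quotient.mk _ (b i) := by
  let B := Module.Basis.ofVectorSpace (V ⧸ maximalIdeal V) (ReducedClosure V L)
  choose b hb using fun i => Ideal.Quotient.mk_surjective (B i)
  exact ⟨_, b, B, fun i => (hb i).symm⟩

variable (V K L) in
theorem finite_reducedClosure [FiniteDimensional K L] :
    Module.Finite (V ⧸ maximalIdeal V) (ReducedClosure V L) := by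
  obtain ⟨ι, b, B, hb⟩ := exists_lift_basis V L
  have hli := B.linearIndependent
  rw [show ⇑B = _ from funext hb] at hli
  have : Finite ι := (linearIndependent_of_reduction (K := K) hli).finite
  exact Module.Finite.of_basis B

theorem finite_of_finrank_reducedClosure_eq [FiniteDimensional K L]
    (h : Module.finrank (V ⧸ maximalIdeal V) (ReducedClosure V L) = Module.finrank K L) :
    Module.Finite V (integralClosure V L) := by
  obtain ⟨ι, b, B, hb⟩ := exists_lift_basis V L
  have hli := B.linearIndependent
  rw [show ⇑B = _ from funext hb] at hli
  have hli' := linearIndependent_of_reduction (K := K) hli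
  have : Finite ι := hli'.finite
  have := Fintype.ofFinite ι
  rw [Module.finrank_eq_card_basis B] at h
  have hspan : Submodule.span K (Set.range fun i => (b i : L)) = ⊤ :=
    hli'.span_eq_top_of_card_eq_finrank' h
  classical
  refine ⟨⟨Finset.univ.image b, ?_⟩⟩
  rw [eq_top_iff, Finset.coe_image, Finset.coe_univ, Set.image_univ]
  intro z _
  have hz : (z : L) ∈ Submodule.span K (Set.range fun i => (b i : L)) := hspan ▸ Submodule.mem_top
  obtain ⟨c, hc⟩ := (Submodule.mem_span_range_iff_exists_fun K).1 hz
  choose a ha using fun i => coeff_mem_range hli Finset.univ c z hc (Finset.mem_univ i)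
  refine (Submodule.mem_span_range_iff_exists_fun V).2 ⟨a, Subtype.ext ?_⟩
  rw [AddSubmonoidClass.coe_finsetSum, ← hc]
  refine Finset.sum_congr rfl fun i _ => ?_
  rw [Subalgebra.coe_smul, ← IsScalarTower.algebraMap_smul K (a i) (b i : L), ha i]

-- Torsion-free modules over a Bézout domain are flat, and finite flat modules over a local ring are
-- free.
variable (V L) in
theorem free_integralClosure [Module.IsTorsionFree V L] [Module.Finite V (integralClosure V L)] :
    Module.Free V (integralClosure V L) := by
  have : Module.Flat V (integralClosure V L) := by
    rw [Module.Flat.flat_iff_torsion_eq_bot_of_isBezout,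
      ← Submodule.isTorsionFree_iff_torsion_eq_bot]
    infer_instance
  exact Module.free_of_flat_of_isLocalRing

theorem isTorsionFree_of_isFractionRing (V K L : Type*) [CommRing V] [IsDomain V] [Field K]
    [Algebra V K] [IsFractionRing V K] [Field L] [Algebra K L] [Algebra V L]
    [IsScalarTower V K L] : Module.IsTorsionFree V L := by
  have : FaithfulSMul V L := by
    rw [faithfulSMul_iff_algebraMap_injective, IsScalarTower.algebraMap_eq V K L]
    exact (algebraMap K L).injective.comp (IsFractionRing.injective V K)
  infer_instance

/-- A basis of the integral closure over `V` is a basis of `L` over `K`. -/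
noncomputable def basisOfIntegralClosure [FiniteDimensional K L] {ι : Type*}
    (b : Module.Basis ι V (integralClosure V L)) : Module.Basis ι K L :=
  have := IsIntegralClosure.isLocalization V K L (integralClosure V L)
  b.localizationLocalization K (nonZeroDivisors V) L

omit [ValuationRing V] in
theorem basisOfIntegralClosure_apply [FiniteDimensional K L] {ι : Type*}
    (b : Module.Basis ι V (integralClosure V L)) (i : ι) :
    basisOfIntegralClosure (K := K) b i = (b i : L) := by
  have := IsIntegralClosure.isLocalization V K L (integralClosure V L)
  exact Module.Basis.localizationLocalization_apply ..

theorem finite_integralClosure_iff [FiniteDimensional K L] :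
    Module.Finite V (integralClosure V L) ↔
      Module.finrank (V ⧸ maximalIdeal V) (ReducedClosure V L) = Module.finrank K L := by
  refine ⟨fun _ => ?_, finite_of_finrank_reducedClosure_eq⟩
  have := isTorsionFree_of_isFractionRing V K L
  have := free_integralClosure V L
  let b := Module.Free.chooseBasis V (integralClosure V L)
  rw [IsLocalRing.finrank_quotient_map, Module.finrank_eq_card_basis b,
    Module.finrank_eq_card_basis (basisOfIntegralClosure (K := K) b)]

end ReductionOfIntegralClosure

end ValRing

/-! ### Extensions of the valuation as localizations of the integral closure -/

namespace ValRing

section Localization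

open Polynomial in
/-- The induction on the degree removes the leading coefficient `a`, which is replaced by the
coefficient `a * x` one degree lower. -/
theorem exists_notMem_mul_eq {B L : Type*} [CommRing B] [Field L] [Algebra B L]
    [IsIntegrallyClosedIn B L] {P : Ideal B} {x : L}
    (hx : ∀ b ∈ P, ∀ c, algebraMap B L c = algebraMap B L b * x → c ∈ P) (n : ℕ) :
    ∀ a : ℕ → B, (∃ i ≤ n, a i ∉ P) → ∑ i ∈ Finset.range (n + 1), algebraMap B L (a i) * x ^ i = 0 →
      ∃ s ∉ P, ∃ c, algebraMap B L c = algebraMap B L s * x := by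
  induction n with
  | zero =>
    rintro a ⟨i, hi, hai⟩ h
    obtain rfl : i = 0 := by omega
    refine ⟨a 0, hai, 0, ?_⟩
    simp only [zero_add, Finset.range_one, Finset.sum_singleton, pow_zero, mul_one] at h
    rw [h, map_zero, zero_mul]
  | succ n ih =>
    rintro a ⟨i, hi, hai⟩ h
    -- The leading coefficient times a root is integral, hence comes from `B`.
    obtain ⟨c, hc⟩ : ∃ c, algebraMap B L c = algebraMap B L (a (n + 1)) * x := by
      rw [← IsIntegrallyClosedIn.isIntegral_iff (R := B), ← Algebra.smul_def]
      by_cases h0 : a (n + 1) = 0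
      · rw [h0, zero_smul]
        exact isIntegral_zero
      · let p : B[X] := ∑ i ∈ Finset.range (n + 2), C (a i) * X ^ i
        have hp : p.natDegree = n + 1 := by
          refine natDegree_eq_of_le_of_coeff_ne_zero ?_ ?_
          · refine natDegree_sum_le_of_forall_le _ _ fun i hi => ?_
            exact (natDegree_C_mul_X_pow_le _ _).trans (by rw [Finset.mem_range] at hi; omega)
          · simpa [p, finsetSum_coeff, coeff_C_mul, coeff_X_pow] using h0
        have hl : p.leadingCoeff = a (n + 1) := by
          rw [leadingCoeff, hp]
          simp [p, finsetSum_coeff, coeff_C_mul, coeff_X_pow]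
        rw [← hl]
        refine isIntegral_leadingCoeff_smul p x ?_
        simpa [p] using h
    -- If the leading coefficient is in `P`, then so is `c`. Adding `c` to `a n` changes nothing
    -- modulo `P`, so some coefficient stays outside `P`.
    by_cases hn : a (n + 1) ∈ P
    · have hcP := hx _ hn c hc
      refine ih (fun i => if i = n then a n + c else a i) ?_ ?_
      · obtain rfl | hin := eq_or_ne i (n + 1)
        · exact (hai hn).elim
        · refine ⟨i, by omega, ?_⟩
          by_cases h' : i = n
          · subst h'
            simp only [if_true]
            exact fun h => hai ((Submodule.add_mem_iff_left _ hcP).1 h)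
          · rwa [if_neg h']
      · rw [Finset.sum_range_succ, Finset.sum_range_succ] at h
        rw [Finset.sum_range_succ, if_pos rfl]
        have : ∀ i ∈ Finset.range n, algebraMap B L (if i = n then a n + c else a i) * x ^ i =
            algebraMap B L (a i) * x ^ i := by
          intro i hi
          rw [if_neg (Finset.mem_range.1 hi).ne]
        rw [Finset.sum_congr rfl this, map_add, hc, ← h]
        ring
    · exact ⟨_, hn, c, hc⟩

open Polynomial in
theorem exists_eq_C_mul_coeff_eq_one {V : Type*} [CommRing V] [IsDomain V] [ValuationRing V]
    {p : V[X]} (hp : p ≠ 0) : ∃ c ≠ 0, ∃ q : V[X], p = C c * q ∧ ∃ i, q.coeff i = 1 := by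
  obtain ⟨i, hi, hmax⟩ := p.support.exists_max_image
    (fun i => ValuationRing.valuation V (FractionRing V) (algebraMap V _ (p.coeff i)))
    (support_nonempty.2 hp)
  rw [mem_support_iff] at hi
  obtain ⟨q, hq⟩ : C (p.coeff i) ∣ p := by
    rw [C_dvd_iff_dvd_coeff]
    intro j
    by_cases hj : p.coeff j = 0
    · exact hj ▸ dvd_zero _
    -- The order of the value group unfolds to divisibility, so the inequality carries the quotient
    -- `c`.
    · obtain ⟨c, hc⟩ := hmax j (mem_support_iff.2 hj)
      refine ⟨c, IsFractionRing.injective V (FractionRing V) ?_⟩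
      rw [mul_comm, map_mul, ← Algebra.smul_def]
      exact hc.symm
  refine ⟨_, hi, q, hq, i, mul_left_cancel₀ hi ?_⟩
  conv_rhs => rw [mul_one, hq, coeff_C_mul]

end Localization

namespace Extension

variable {V K L : Type*} [CommRing V] [IsDomain V] [ValuationRing V] [Field K]
  [Algebra V K] [IsFractionRing V K] [Field L] [Algebra K L]

noncomputable instance algebra (W : Extension V K L) : Algebra V W.1 :=
  W.inclusion.toAlgebra

instance isLocalHom_algebraMap (W : Extension V K L) : IsLocalHom (algebraMap V W.1) :=
  W.isLocalHom_inclusion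

/-- The reduction of the valuation ring `W` modulo the maximal ideal of `V`. -/
abbrev Reduction (W : Extension V K L) : Type _ :=
  W.1 ⧸ (maximalIdeal V).map (algebraMap V W.1)

variable [Algebra V L] [IsScalarTower V K L]

theorem coe_algebraMap (W : Extension V K L) (a : V) :
    ((algebraMap V W.1 a : W.1) : L) = algebraMap V L a :=
  (IsScalarTower.algebraMap_apply V K L a).symm

instance isScalarTower (W : Extension V K L) : IsScalarTower V W.1 L :=
  IsScalarTower.of_algebraMap_eq fun a => (W.coe_algebraMap a).symm

theorem mem_of_mem_integralClosure (W : Extension V K L) {x : L} (hx : x ∈ integralClosure V L) :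
    x ∈ W.1 := by
  have : IsIntegral W.1 x := IsIntegral.tower_top (R := V) hx
  obtain ⟨y, hy⟩ := IsIntegrallyClosed.isIntegral_iff.1 this
  exact hy ▸ y.2

/-- The inclusion of the integral closure of `V` in `W`. -/
noncomputable def ofIntegralClosure (W : Extension V K L) : integralClosure V L →ₐ[V] W.1 where
  toFun b := ⟨b, W.mem_of_mem_integralClosure b.2⟩
  map_one' := rfl
  map_mul' _ _ := rfl
  map_zero' := rfl
  map_add' _ _ := rfl
  commutes' a := Subtype.ext (W.coe_algebraMap a).symm

/-- The centre of `W` on the integral closure of `V`. -/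
noncomputable def center (W : Extension V K L) : Ideal (integralClosure V L) :=
  (maximalIdeal W.1).comap W.ofIntegralClosure

theorem mem_center (W : Extension V K L) {b : integralClosure V L} :
    b ∈ W.center ↔ W.1.valuation (b : L) < 1 :=
  W.1.valuation_lt_one_iff _

instance isPrime_center (W : Extension V K L) : W.center.IsPrime :=
  Ideal.comap_isPrime _ _

theorem map_le_center (W : Extension V K L) :
    (maximalIdeal V).map (algebraMap V (integralClosure V L)) ≤ W.center := by
  rw [Ideal.map_le_iff_le_comap]
  intro a ha
  rw [Ideal.mem_comap, center, Ideal.mem_comap, AlgHom.commutes]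
  exact map_nonunit (algebraMap V W.1) a ha

/-- This makes `W` the localization of `B` at its centre. Scaled to have a coefficient 1, a
polynomial over `V` killing `x` has a coefficient outside the centre, and multiplication by `x` in
`W` keeps values below 1, so `exists_notMem_mul_eq` applies. -/
theorem exists_notMem_center_mul_eq [FiniteDimensional K L] (W : Extension V K L) {x : L}
    (hx : x ∈ W.1) : ∃ s ∉ W.center, ∃ c : integralClosure V L, (c : L) = s * x := by
  have halg : IsAlgebraic V x :=
    (IsFractionRing.isAlgebraic_iff V K L).2 (Algebra.IsAlgebraic.isAlgebraic x)
  obtain ⟨p, hp0, hp⟩ := halg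
  obtain ⟨c, hc, q, rfl, i, hi⟩ := exists_eq_C_mul_coeff_eq_one hp0
  have hq : Polynomial.aeval x q = 0 := by
    rw [map_mul, Polynomial.aeval_C, mul_eq_zero] at hp
    refine hp.resolve_left ?_
    rw [IsScalarTower.algebraMap_apply V K L]
    simpa using hc
  refine exists_notMem_mul_eq (B := integralClosure V L) (P := W.center) ?_ q.natDegree
    (fun j => algebraMap V _ (q.coeff j)) ⟨i, ?_, ?_⟩ ?_
  · intro b hb c hc
    rw [mem_center] at hb ⊢
    have hc' : (c : L) = b * x := hc
    rw [hc', map_mul]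
    exact mul_lt_one_of_lt_of_le hb (W.1.valuation_le_one ⟨x, hx⟩)
  · exact Polynomial.le_natDegree_of_ne_zero (hi ▸ one_ne_zero)
  · intro h
    rw [hi, map_one] at h
    exact W.isPrime_center.one_notMem h
  · rw [Polynomial.aeval_eq_sum_range] at hq
    rw [← hq]
    refine Finset.sum_congr rfl fun j _ => ?_
    rw [Algebra.smul_def]
    rfl

theorem mem_iff_exists [FiniteDimensional K L] (W : Extension V K L) {x : L} :
    x ∈ W.1 ↔ ∃ s ∉ W.center, ∃ c : integralClosure V L, (c : L) = s * x := by
  refine ⟨W.exists_notMem_center_mul_eq, ?_⟩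
  rintro ⟨s, hs, c, hc⟩
  rw [mem_center, not_lt] at hs
  have h1 : W.1.valuation (s : L) = 1 :=
    le_antisymm ((W.1.valuation_le_one_iff _).2 (W.mem_of_mem_integralClosure s.2)) hs
  have h2 := (W.1.valuation_le_one_iff _).2 (W.mem_of_mem_integralClosure c.2)
  rw [hc, map_mul, h1, one_mul] at h2
  exact (W.1.valuation_le_one_iff _).1 h2

theorem center_injective [FiniteDimensional K L] :
    Function.Injective (center : Extension V K L → Ideal (integralClosure V L)) := by
  intro W W' h
  refine Subtype.ext (SetLike.ext fun x => ?_)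
  rw [mem_iff_exists, mem_iff_exists, h]

/-- Some valuation ring `W` of `L` contains `B` and has `P` among its nonunits. It contracts to `V`:
if `x` is in `K` but not in `V`, then `x⁻¹` comes from `m`, is a nonunit of `W`, and `x` is not in
`W`. -/
theorem exists_le_center {P : Ideal (integralClosure V L)} (hP : P ≠ ⊤)
    (hle : (maximalIdeal V).map (algebraMap V (integralClosure V L)) ≤ P) :
    ∃ W : Extension V K L, P ≤ W.center := by
  obtain ⟨W, hBW, hPW⟩ := Ideal.image_subset_nonunits_valuationSubring
    (A := (integralClosure V L).toSubring) P hP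
  have hW : ∀ x : K, algebraMap K L x ∈ W ↔ x ∈ (algebraMap V K).range := by
    intro x
    constructor
    · intro hx
      by_contra hxV
      have hx0 : x ≠ 0 := fun h => hxV (h ▸ zero_mem _)
      obtain ⟨a, ha, hax⟩ := mem_maximalIdeal_of_inv_notMem_range hx0 hxV
      have := hPW ⟨_, hle (Ideal.mem_map_of_mem _ ha), rfl⟩
      rw [SetLike.mem_coe, ValuationSubring.mem_nonunits_iff] at this
      have hval : (integralClosure V L).toSubring.subtype
          (algebraMap V (integralClosure V L) a) = (algebraMap K L x)⁻¹ := by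
        rw [← map_inv₀, ← hax, ← IsScalarTower.algebraMap_apply]
        rfl
      rw [hval, map_inv₀] at this
      rw [← W.valuation_le_one_iff] at hx
      have hv0 : W.valuation (algebraMap K L x) ≠ 0 := by simpa using hx0
      exact (inv_lt_one₀ (zero_lt_iff.2 hv0)).1 this |>.not_ge hx
    · rintro ⟨a, rfl⟩
      rw [← IsScalarTower.algebraMap_apply]
      exact hBW (algebraMap_mem (integralClosure V L) a)
  let W' : Extension V K L := ⟨W, hW⟩
  exact ⟨W', fun b hb => W'.mem_center.2 (W.mem_nonunits_iff.1 (hPW ⟨b, hb, rfl⟩))⟩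

end Extension

end ValRing

/-! ### Decomposition of the reduction over the extensions -/

namespace ValRing

theorem toNat_length_eq_finrank (R k M : Type*) [CommRing R] [Field k] [Algebra R k]
    [AddCommGroup M] [Module R M] [Module k M] [IsScalarTower R k M]
    (h : Function.Surjective (algebraMap R k)) :
    (Module.length R M).toNat = Module.finrank k M := by
  rw [Module.length_eq_of_surjective (R := k) h, Module.length_eq_rank, Module.finrank,
    Cardinal.toNat_toENat]

theorem toNat_length_eq_finrank_atPrime {R k A : Type*} [CommRing R] [Field k] [Algebra R k]
    [CommRing A] [Algebra R A] [Algebra k A] [IsScalarTower R k A]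
    (h : Function.Surjective (algebraMap R k)) (p : Ideal A) [p.IsPrime] (S : Type*) [CommRing S]
    [Algebra A S] [Module R S] [IsScalarTower R A S] [IsLocalization.AtPrime S p] :
    (Module.length R S).toNat = Module.finrank k (Localization.AtPrime p) := by
  let e := IsLocalization.algEquiv p.primeCompl S (Localization.AtPrime p)
  rw [(e.toLinearEquiv.restrictScalars R).length_eq]
  exact toNat_length_eq_finrank R k _ h

namespace Extension

variable {V K L : Type*} [CommRing V] [IsDomain V] [ValuationRing V] [Field K]
  [Algebra V K] [IsFractionRing V K] [Field L] [Algebra K L] [Algebra V L] [IsScalarTower V K L]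

/-- The reduction modulo the maximal ideal of `V` of the inclusion of the integral closure of `V`
in `W`. -/
noncomputable def ofReducedClosure (W : Extension V K L) : ReducedClosure V L →+* W.Reduction :=
  Ideal.quotientMap _ W.ofIntegralClosure.toRingHom <| by
    rw [Ideal.map_le_iff_le_comap]
    intro a ha
    rw [Ideal.mem_comap, Ideal.mem_comap]
    change W.ofIntegralClosure (algebraMap V _ a) ∈ _
    rw [AlgHom.commutes]
    exact Ideal.mem_map_of_mem _ ha

noncomputable instance algebraReducedClosure (W : Extension V K L) :
    Algebra (ReducedClosure V L) W.Reduction :=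
  W.ofReducedClosure.toAlgebra

noncomputable instance smulReducedClosure (W : Extension V K L) :
    SMul (ReducedClosure V L) W.Reduction :=
  Algebra.toSMul

instance isScalarTowerReducedClosure (W : Extension V K L) :
    IsScalarTower V (ReducedClosure V L) W.Reduction where
  smul_assoc a x z := by
    obtain ⟨b, rfl⟩ := Ideal.Quotient.mk_surjective x
    obtain ⟨w, rfl⟩ := Ideal.Quotient.mk_surjective z
    change Ideal.Quotient.mk _ (W.ofIntegralClosure (a • b) * w) =
      Ideal.Quotient.mk _ (a • (W.ofIntegralClosure b * w))
    rw [map_smul, smul_mul_assoc]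

/-- The centre of `W` on the reduction of the integral closure of `V`. -/
noncomputable def reducedCenter (W : Extension V K L) : Ideal (ReducedClosure V L) :=
  W.center.map (Ideal.Quotient.mk _)

theorem comap_reducedCenter (W : Extension V K L) :
    W.reducedCenter.comap (Ideal.Quotient.mk _) = W.center := by
  rw [reducedCenter, Ideal.comap_map_of_surjective _ Ideal.Quotient.mk_surjective]
  rw [← RingHom.ker_eq_comap_bot, Ideal.mk_ker, sup_eq_left]
  exact W.map_le_center

theorem mk_mem_reducedCenter (W : Extension V K L) {b : integralClosure V L} :
    Ideal.Quotient.mk _ b ∈ W.reducedCenter ↔ b ∈ W.center := by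
  rw [← Ideal.mem_comap, comap_reducedCenter]

instance isPrime_reducedCenter (W : Extension V K L) : W.reducedCenter.IsPrime :=
  Ideal.map_isPrime_of_surjective Ideal.Quotient.mk_surjective <| by
    rw [Ideal.mk_ker]
    exact W.map_le_center

variable [FiniteDimensional K L]

-- For surjectivity, `exists_le_center` gives a centre containing a given prime; primes of the
-- artinian ring `B/mB` are maximal, so the two agree.
variable (V K L) in
theorem bijective_reducedCenter : Function.Bijective
    (fun W : Extension V K L =>
      (⟨W.reducedCenter, inferInstance⟩ : PrimeSpectrum (ReducedClosure V L))) := by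
  constructor
  · intro W W' h
    apply center_injective
    rw [← comap_reducedCenter, ← comap_reducedCenter]
    exact congrArg (fun p => Ideal.comap _ (PrimeSpectrum.asIdeal p)) h
  · intro p
    have := finite_reducedClosure V K L
    have : IsArtinianRing (ReducedClosure V L) :=
      IsArtinianRing.of_finite (V ⧸ maximalIdeal V) _
    obtain ⟨W, hW⟩ := exists_le_center (K := K)
      (P := p.asIdeal.comap (Ideal.Quotient.mk _)) (Ideal.IsPrime.ne_top inferInstance) <| by
        intro b hb
        rw [Ideal.mem_comap, Ideal.Quotient.eq_zero_iff_mem.2 hb]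
        exact zero_mem _
    refine ⟨W, PrimeSpectrum.ext (Eq.symm ?_)⟩
    have hmax : p.asIdeal.IsMaximal := inferInstance
    refine hmax.eq_of_le W.isPrime_reducedCenter.ne_top fun x hx => ?_
    obtain ⟨b, rfl⟩ := Ideal.Quotient.mk_surjective x
    exact W.mk_mem_reducedCenter.2 (hW hx)

theorem exists_eq_smul_of_mem_map {S : Type*} [CommRing S] [Algebra V S] {y : S}
    (hy : y ∈ (maximalIdeal V).map (algebraMap V S)) :
    ∃ a ∈ maximalIdeal V, ∃ w : S, y = algebraMap V S a * w := by
  refine Submodule.span_induction ?_ ?_ ?_ ?_ hy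
  · rintro _ ⟨a, ha, rfl⟩
    exact ⟨a, ha, 1, (mul_one _).symm⟩
  · exact ⟨0, zero_mem _, 0, by simp⟩
  · rintro _ _ - - ⟨a, ha, w, rfl⟩ ⟨a', ha', w', rfl⟩
    obtain ⟨c, rfl | rfl⟩ := ValuationRing.cond a a'
    · exact ⟨a, ha, w + algebraMap V S c * w', by rw [map_mul]; ring⟩
    · exact ⟨a', ha', algebraMap V S c * w + w', by rw [map_mul]; ring⟩
  · rintro s _ - ⟨a, ha, w, rfl⟩
    exact ⟨a, ha, s * w, by rw [smul_eq_mul]; ring⟩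

theorem isUnit_ofIntegralClosure (W : Extension V K L) {b : integralClosure V L}
    (hb : b ∉ W.center) : IsUnit (W.ofIntegralClosure b) := by
  by_contra h
  exact hb h

/-- Localization commutes with reduction. If `b - b' = a * w` with `a` in `m`, a denominator `s` of
`w` outside the centre brings `s * (b - b')` into `mB`. -/
instance isLocalization_reduction (W : Extension V K L) :
    IsLocalization.AtPrime W.Reduction W.reducedCenter where
  map_units := by
    rintro ⟨x, hx⟩
    obtain ⟨b, rfl⟩ := Ideal.Quotient.mk_surjective x
    have hb : b ∉ W.center := fun h => hx (W.mk_mem_reducedCenter.2 h)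
    exact (W.isUnit_ofIntegralClosure hb).map (Ideal.Quotient.mk _)
  surj := by
    intro z
    obtain ⟨w, rfl⟩ := Ideal.Quotient.mk_surjective z
    obtain ⟨s, hs, c, hc⟩ := W.exists_notMem_center_mul_eq w.2
    refine ⟨(Ideal.Quotient.mk _ c, ⟨Ideal.Quotient.mk _ s,
      fun h => hs (W.mk_mem_reducedCenter.1 h)⟩), ?_⟩
    change Ideal.Quotient.mk _ w * Ideal.Quotient.mk _ (W.ofIntegralClosure s) =
      Ideal.Quotient.mk _ (W.ofIntegralClosure c)
    rw [← map_mul]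
    congr 1
    apply Subtype.ext
    rw [mul_comm]
    exact hc.symm
  exists_of_eq := by
    intro x y hxy
    obtain ⟨b, rfl⟩ := Ideal.Quotient.mk_surjective x
    obtain ⟨b', rfl⟩ := Ideal.Quotient.mk_surjective y
    have h1 : Ideal.Quotient.mk _ (W.ofIntegralClosure b) =
      Ideal.Quotient.mk ((maximalIdeal V).map (algebraMap V W.1)) (W.ofIntegralClosure b') := hxy
    rw [Ideal.Quotient.mk_eq_mk_iff_sub_mem, ← map_sub] at h1
    obtain ⟨a, ha, w, hw⟩ := exists_eq_smul_of_mem_map h1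
    obtain ⟨s, hs, c, hc⟩ := W.exists_notMem_center_mul_eq w.2
    refine ⟨⟨Ideal.Quotient.mk _ s, fun h => hs (W.mk_mem_reducedCenter.1 h)⟩, ?_⟩
    change Ideal.Quotient.mk _ s * Ideal.Quotient.mk _ b =
      Ideal.Quotient.mk _ s * Ideal.Quotient.mk _ b'
    rw [← map_mul, ← map_mul, Ideal.Quotient.mk_eq_mk_iff_sub_mem, ← mul_sub]
    have : s * (b - b') = algebraMap V _ a * c := by
      apply Subtype.ext
      have hw' : ((b - b' : integralClosure V L) : L) = algebraMap V L a * (w : L) := by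
        rw [← W.coe_algebraMap a]
        exact congrArg Subtype.val hw
      rw [MulMemClass.coe_mul, MulMemClass.coe_mul, hw', hc]
      change _ = algebraMap V L a * _
      ring
    rw [this]
    exact Ideal.mul_mem_right _ _ (Ideal.mem_map_of_mem _ ha)

set_option synthInstance.maxHeartbeats 200000 in
variable (V K L) in
theorem finrank_reducedClosure :
    Module.finrank (V ⧸ maximalIdeal V) (ReducedClosure V L) =
      ∑ᶠ W : Extension V K L, (Module.length V W.Reduction).toNat := by
  have := finite_reducedClosure V K L
  have : IsArtinianRing (ReducedClosure V L) :=
    IsArtinianRing.of_finite (V ⧸ maximalIdeal V) _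
  have := Fintype.ofFinite (PrimeSpectrum (ReducedClosure V L))
  rw [IsArtinianRing.finrank_eq_sum_primeSpectrum, ← finsum_eq_sum_of_fintype]
  refine Eq.symm (finsum_eq_of_bijective _ (bijective_reducedCenter V K L) fun W => ?_)
  exact toNat_length_eq_finrank_atPrime Ideal.Quotient.mk_surjective W.reducedCenter W.Reduction

-- A localization of an artinian ring is a quotient of it.
set_option synthInstance.maxHeartbeats 200000 in
theorem length_reduction_ne_top (W : Extension V K L) : Module.length V W.Reduction ≠ ⊤ := by
  have := finite_reducedClosure V K L
  have : IsArtinianRing (ReducedClosure V L) :=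
    IsArtinianRing.of_finite (V ⧸ maximalIdeal V) _
  have hs : Function.Surjective (algebraMap (ReducedClosure V L) W.Reduction) :=
    IsArtinianRing.localization_surjective W.reducedCenter.primeCompl W.Reduction
  have hle := Module.length_le_of_surjective
    (IsScalarTower.toAlgHom V (ReducedClosure V L) W.Reduction).toLinearMap hs
  refine ne_top_of_le_ne_top ?_ hle
  rw [Module.length_eq_of_surjective (R := V ⧸ maximalIdeal V) Ideal.Quotient.mk_surjective,
    Module.length_eq_finrank]
  exact ENat.natCast_ne_top _

end Extension

end ValRing

/-! ### The length of `W/mW` as `e * f` -/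

namespace ValRing

theorem length_quotient_congr (R : Type*) {S : Type*} [CommRing R] [CommRing S] [Algebra R S]
    {I J : Ideal S} (h : I = J) : Module.length R (S ⧸ I) = Module.length R (S ⧸ J) := by
  rw [h]

-- Induction along `0 → S/(t ^ n) → S/(t ^ (n + 1)) → S/(t) → 0`, the first map being multiplication
-- by `t`.
open Pointwise in
theorem length_quotient_span_pow (R : Type*) {S : Type*} [CommRing R] [CommRing S] [IsDomain S]
    [Algebra R S] {t : S} (ht : t ≠ 0) (n : ℕ) :
    Module.length R (S ⧸ Ideal.span {t ^ n}) = n * Module.length R (S ⧸ Ideal.span {t}) := by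
  induction n with
  | zero =>
    rw [pow_zero, Ideal.span_singleton_one, Nat.cast_zero, zero_mul]
    have : Subsingleton (S ⧸ (⊤ : Ideal S)) := Ideal.Quotient.subsingleton_iff.2 rfl
    exact Module.length_eq_zero
  | succ n ih =>
    have h := Module.length_eq_add_of_exact
      ((Ideal.mulQuot t (Ideal.span {t ^ n})).restrictScalars R)
      ((Ideal.quotOfMul t (Ideal.span {t ^ n})).restrictScalars R)
      (Ideal.mulQuot_injective _ (mem_nonZeroDivisors_of_ne_zero ht))
      (Ideal.quotOfMul_surjective _) (Ideal.exact_mulQuot_quotOfMul _)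
    have hI : t • Ideal.span {t ^ n} = Ideal.span {t ^ (n + 1)} := by
      rw [← Submodule.singleton_set_smul, pow_succ', ← Ideal.submodule_span_eq,
        Submodule.set_smul_span]
      simp
    rw [hI, ih] at h
    rw [h, Nat.cast_succ, add_mul, one_mul]

/-- The powers of `w(ϖ)` form a convex subgroup, so the quotient by it has no torsion. Concretely,
for `b ≥ 0` the largest power of `ϖ` dividing `z` leaves a unit. -/
theorem exists_valuation_eq_zpow_of_pow_eq {L : Type*} [Field L] (W : ValuationSubring L) {ϖ : W}
    (hϖ : maximalIdeal W = Ideal.span {ϖ}) (hϖ0 : ϖ ≠ 0) {z : L} {n : ℕ} (hn : n ≠ 0) {b : ℤ}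
    (h : W.valuation z ^ n = W.valuation (ϖ : L) ^ b) :
    ∃ j : ℤ, W.valuation z = W.valuation (ϖ : L) ^ j := by
  have hlt : W.valuation (ϖ : L) < 1 :=
    (W.valuation_lt_one_iff ϖ).1 (hϖ ▸ Ideal.mem_span_singleton_self ϖ)
  have hv0 : W.valuation (ϖ : L) ≠ 0 := by simpa using hϖ0
  have key : ∀ (z : L) (b : ℕ), W.valuation z ^ n = W.valuation (ϖ : L) ^ b →
      ∃ j : ℤ, W.valuation z = W.valuation (ϖ : L) ^ j := by
    intro z b h
    have hzW : z ∈ W := by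
      rw [← W.valuation_le_one_iff, ← pow_le_one_iff_of_nonneg zero_le hn, h]
      exact pow_le_one₀ zero_le hlt.le
    have hfin : FiniteMultiplicity ϖ ⟨z, hzW⟩ := by
      refine ⟨b, ?_⟩
      rintro ⟨c, hc⟩
      have hz : z = (ϖ : L) ^ (b + 1) * c := congrArg Subtype.val hc
      have hle : W.valuation z ≤ W.valuation (ϖ : L) ^ (b + 1) := by
        rw [hz, map_mul, map_pow]
        exact mul_le_of_le_one_right zero_le (W.valuation_le_one c)
      have hlt' : W.valuation (ϖ : L) ^ (b + 1) < W.valuation (ϖ : L) ^ b :=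
        pow_lt_pow_right_of_lt_one₀ (zero_lt_iff.2 hv0) hlt (Nat.lt_succ_self b)
      have h1 : (W.valuation (ϖ : L) ^ (b + 1)) ^ n ≤ W.valuation (ϖ : L) ^ (b + 1) :=
        pow_le_of_le_one zero_le (pow_le_one₀ zero_le hlt.le) hn
      exact absurd (h ▸ pow_le_pow_left₀ zero_le hle n) ((h1.trans_lt hlt').not_ge)
    obtain ⟨c, hc, hndvd⟩ := hfin.exists_eq_pow_mul_and_not_dvd
    have hcu : W.valuation (c : L) = 1 := by
      rw [← W.valuation_eq_one_iff]
      by_contra hcu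
      have : c ∈ maximalIdeal W := hcu
      rw [hϖ, Ideal.mem_span_singleton] at this
      exact hndvd this
    refine ⟨(multiplicity ϖ ⟨z, hzW⟩ : ℕ), ?_⟩
    have hz : z = (ϖ : L) ^ (multiplicity ϖ ⟨z, hzW⟩) * c := congrArg Subtype.val hc
    rw [zpow_natCast, ← map_pow]
    conv_lhs => rw [hz, map_mul, hcu, mul_one]
  obtain ⟨b, rfl | rfl⟩ := b.eq_nat_or_neg
  · exact key z b (by rw [h, zpow_natCast])
  · obtain ⟨j, hj⟩ := key z⁻¹ b (by rw [map_inv₀, inv_pow, h, zpow_neg, inv_inv, zpow_natCast])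
    exact ⟨-j, by rw [zpow_neg, ← hj, map_inv₀, inv_inv]⟩

/-- In a polynomial relation for `y` the largest value occurs at two different terms, since a unique
maximum would be the value of the zero sum. Their quotient expresses a power of `w y`. -/
theorem exists_pow_valuation_eq {K L Γ : Type*} [Field K] [Field L] [Algebra K L]
    [Algebra.IsAlgebraic K L] [LinearOrderedCommGroupWithZero Γ] (w : Valuation L Γ) {y : L}
    (hy : y ≠ 0) : ∃ n ≠ 0, ∃ c : K, w y ^ n = w (algebraMap K L c) := by
  classical
  obtain ⟨p, hp0, hp⟩ := Algebra.IsAlgebraic.isAlgebraic (R := K) y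
  have hne : ∀ i ∈ p.support, w (p.coeff i • y ^ i) ≠ 0 := by
    intro i hi
    rw [Polynomial.mem_support_iff] at hi
    simp [hi, hy]
  obtain ⟨j, hj, hmax⟩ := p.support.exists_max_image (fun i => w (p.coeff i • y ^ i))
    (Polynomial.support_nonempty.2 hp0)
  obtain ⟨i, hi, hij, heq⟩ : ∃ i ∈ p.support, i ≠ j ∧
      w (p.coeff i • y ^ i) = w (p.coeff j • y ^ j) := by
    by_contra! hcon
    have := Valuation.map_sum_eq_of_lt (v := w) (s := p.support) (f := fun i => p.coeff i • y ^ i)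
      hj fun i hi => by
        rw [Finset.mem_sdiff, Finset.mem_singleton] at hi
        exact lt_of_le_of_ne (hmax i hi.1) (hcon i hi.1 hi.2)
    rw [Polynomial.aeval_def, Polynomial.eval₂_eq_sum, Polynomial.sum_def] at hp
    simp_rw [Algebra.smul_def] at this
    rw [hp, map_zero, ← Algebra.smul_def] at this
    exact hne j hj this.symm
  have key : ∀ i j, i ∈ p.support → j ∈ p.support → i < j →
      w (p.coeff i • y ^ i) = w (p.coeff j • y ^ j) →
      ∃ n ≠ 0, ∃ c : K, w y ^ n = w (algebraMap K L c) := by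
    intro i j hi hj hij h
    refine ⟨j - i, by omega, p.coeff i / p.coeff j, ?_⟩
    rw [Polynomial.mem_support_iff] at hi hj
    have hwy : w y ≠ 0 := by simpa using hy
    have hwj : w (algebraMap K L (p.coeff j)) ≠ 0 := by simpa using hj
    rw [Algebra.smul_def, Algebra.smul_def, map_mul, map_mul, map_pow, map_pow] at h
    rw [map_div₀, map_div₀, eq_div_iff hwj]
    apply mul_right_cancel₀ (pow_ne_zero i hwy)
    rw [h, mul_right_comm, ← pow_add, Nat.sub_add_cancel hij.le, mul_comm]
  rcases hij.lt_or_gt with h | h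
  · exact key i j hi hj h heq
  · exact key j i hj hi h heq.symm

namespace Extension

variable {V K L : Type*} [CommRing V] [IsDomain V] [ValuationRing V] [Field K]
  [Algebra V K] [IsFractionRing V K] [Field L] [Algebra K L] [Algebra V L] [IsScalarTower V K L]

theorem isEquiv_comap (W : Extension V K L) :
    (ValuationRing.valuation V K).IsEquiv (W.1.valuation.comap (algebraMap K L)) := by
  refine Valuation.isEquiv_of_val_le_one fun x => ?_
  rw [valuation_le_one_iff_mem_range, ← W.2 x, Valuation.comap_apply, W.1.valuation_le_one_iff]

theorem mem_baseValues (W : Extension V K L) {g : (W.1.ValueGroup)ˣ} :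
    g ∈ W.baseValues ↔ ∃ c : K, W.1.valuation (algebraMap K L c) = g := by
  constructor
  · rintro ⟨c, rfl⟩
    exact ⟨c, rfl⟩
  · rintro ⟨c, hc⟩
    have hc0 : c ≠ 0 := by
      rintro rfl
      rw [map_zero, map_zero] at hc
      exact g.ne_zero hc.symm
    exact ⟨Units.mk0 c hc0, Units.ext hc⟩

theorem exists_mem_maximalIdeal_of_valuation_lt_one (W : Extension V K L) {c : K}
    (hc : W.1.valuation (algebraMap K L c) < 1) : ∃ a ∈ maximalIdeal V, algebraMap V K a = c := by
  obtain ⟨a, rfl⟩ := (W.2 c).1 ((W.1.valuation_le_one_iff _).1 hc.le)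
  refine ⟨a, ?_, rfl⟩
  rw [← IsScalarTower.algebraMap_apply, ← W.coe_algebraMap] at hc
  have := (W.1.valuation_lt_one_iff _).2 hc
  exact fun hu => this (hu.map _)

theorem length_residueField (W : Extension V K L) :
    (Module.length V (W.1 ⧸ maximalIdeal W.1)).toNat = W.inertiaDegree := by
  let A : Algebra (ResidueField V) (ResidueField W.1) := (ResidueField.map W.inclusion).toAlgebra
  have : @IsScalarTower V (ResidueField V) (ResidueField W.1) _ A.toSMul _ :=
    @IsScalarTower.of_algebraMap_eq V (ResidueField V) (ResidueField W.1) _ _ _ _ A _ fun a => rfl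
  exact @toNat_length_eq_finrank V (ResidueField V) (ResidueField W.1) _ _ _ _ _ A.toModule this
    Ideal.Quotient.mk_surjective

variable [FiniteDimensional K L]

/-- Some power `w(y) ^ n` lies in the base value group; divisibility and uniqueness of `n`-th roots
put `w(y)` there too. Hence `e = 1` and `mW` is the whole maximal ideal of `W`. -/
theorem length_reduction_of_divisible (W : Extension V K L)
    (h : ∀ n : ℕ, n ≠ 0 → ∀ x : K, x ≠ 0 →
      ∃ d : K, ValuationRing.valuation V K x = ValuationRing.valuation V K d ^ n) :
    (Module.length V W.Reduction).toNat = W.ramificationIndex * W.inertiaDegree := by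
  have hval : ∀ y : L, y ≠ 0 → ∃ d : K, W.1.valuation y = W.1.valuation (algebraMap K L d) := by
    intro y hy
    obtain ⟨n, hn, c, hc⟩ := exists_pow_valuation_eq (K := K) W.1.valuation hy
    have hc0 : c ≠ 0 := by
      rintro rfl
      rw [map_zero, map_zero] at hc
      exact hy (by simpa using eq_zero_of_pow_eq_zero hc)
    obtain ⟨d, hd⟩ := h n hn c hc0
    rw [← map_pow, W.isEquiv_comap.eq_iff, Valuation.comap_apply, Valuation.comap_apply, ← hc,
      map_pow, map_pow] at hd
    exact ⟨d, (pow_left_inj₀ zero_le zero_le hn).1 hd⟩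
  have he : W.ramificationIndex = 1 := by
    rw [ramificationIndex, Subgroup.index_eq_one, eq_top_iff]
    intro g _
    obtain ⟨y, hy⟩ := W.1.valuation_surjective (g : W.1.ValueGroup)
    have hy0 : y ≠ 0 := by
      rintro rfl
      rw [map_zero] at hy
      exact g.ne_zero hy.symm
    obtain ⟨d, hd⟩ := hval y hy0
    exact W.mem_baseValues.2 ⟨d, hd ▸ hy⟩
  have hm : (maximalIdeal V).map (algebraMap V W.1) = maximalIdeal W.1 := by
    refine le_antisymm ?_ fun y hy => ?_
    · rw [Ideal.map_le_iff_le_comap]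
      exact fun a ha => map_nonunit (algebraMap V W.1) a ha
    · by_cases hy0 : (y : L) = 0
      · rw [show y = 0 from Subtype.ext hy0]
        exact zero_mem _
      · obtain ⟨d, hd⟩ := hval y hy0
        rw [W.1.valuation_lt_one_iff, hd] at hy
        obtain ⟨a, ha, rfl⟩ := W.exists_mem_maximalIdeal_of_valuation_lt_one hy
        obtain ⟨u, hu⟩ := (W.1.valuation_le_iff _ _).1 hd.le
        have : y = u * algebraMap V W.1 a := by
          apply Subtype.ext
          rw [← hu, MulMemClass.coe_mul, W.coe_algebraMap, ← IsScalarTower.algebraMap_apply]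
        rw [this]
        exact Ideal.mul_mem_left _ _ (Ideal.mem_map_of_mem _ ha)
  rw [he, one_mul, ← length_residueField]
  exact congrArg ENat.toNat (length_quotient_congr V hm)

/-- `W/mW` has finite length, so the maximal ideal of `W` is finitely generated modulo the principal
ideal `mW`. Being finitely generated, it is principal, as `W` is Bézout. -/
theorem exists_maximalIdeal_eq_span (W : Extension V K L) {π : V}
    (hπ : maximalIdeal V = Ideal.span {π}) : ∃ ϖ : W.1, maximalIdeal W.1 = Ideal.span {ϖ} := by
  have hN : IsNoetherian V W.Reduction :=
    (isFiniteLength_iff_isNoetherian_isArtinian.1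
      (Module.length_ne_top_iff.1 W.length_reduction_ne_top)).1
  have hN' : IsNoetherian W.1 W.Reduction := isNoetherian_of_tower V hN
  have hfg : (maximalIdeal W.1).FG := by
    refine Submodule.fg_of_fg_map_of_fg_inf_ker
      (Submodule.mkQ ((maximalIdeal V).map (algebraMap V W.1))) (hN'.noetherian _) ?_
    rw [Submodule.ker_mkQ, inf_eq_right.2]
    · rw [hπ, Ideal.map_span, Set.image_singleton]
      exact ⟨{algebraMap V W.1 π}, by simp⟩
    · rw [Ideal.map_le_iff_le_comap]
      exact fun a ha => map_nonunit (algebraMap V W.1) a ha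
  obtain ⟨ϖ, h⟩ := (IsBezout.isPrincipal_of_FG _ hfg).principal
  exact ⟨ϖ, h⟩

theorem length_reduction_of_discrete (W : Extension V K L) {π : V} (hπ0 : π ≠ 0)
    (hπ : maximalIdeal V = Ideal.span {π})
    (h : ∀ n : ℕ, n ≠ 0 → ∀ x : K, x ≠ 0 → ∃ (a : ℤ) (d : K), ValuationRing.valuation V K x =
      ValuationRing.valuation V K (algebraMap V K π) ^ a * ValuationRing.valuation V K d ^ n) :
    (Module.length V W.Reduction).toNat = W.ramificationIndex * W.inertiaDegree := by
  obtain ⟨ϖ, hϖ⟩ := W.exists_maximalIdeal_eq_span hπ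
  have hπm : π ∈ maximalIdeal V := hπ ▸ Ideal.mem_span_singleton_self π
  have hπW : algebraMap V W.1 π ∈ maximalIdeal W.1 := map_nonunit (algebraMap V W.1) π hπm
  have hπW0 : algebraMap V W.1 π ≠ 0 := by
    intro h0
    have h1 := W.coe_algebraMap π
    rw [h0, IsScalarTower.algebraMap_apply V K L] at h1
    exact hπ0 (by simpa using h1.symm)
  have hϖ0 : ϖ ≠ 0 := by
    rintro rfl
    rw [hϖ, Ideal.mem_span_singleton, zero_dvd_iff] at hπW
    exact hπW0 hπW
  have hv0 : W.1.valuation (ϖ : L) ≠ 0 := by simpa using hϖ0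
  have hvlt : W.1.valuation (ϖ : L) < 1 :=
    (W.1.valuation_lt_one_iff ϖ).1 (hϖ ▸ Ideal.mem_span_singleton_self ϖ)
  have hbase : ∀ c : K, W.1.valuation (algebraMap K L c) < 1 →
      W.1.valuation (algebraMap K L c) ≤ W.1.valuation (algebraMap V W.1 π : W.1) := by
    intro c hc
    obtain ⟨a, ha, rfl⟩ := W.exists_mem_maximalIdeal_of_valuation_lt_one hc
    rw [hπ, Ideal.mem_span_singleton] at ha
    obtain ⟨b, rfl⟩ := ha
    rw [← IsScalarTower.algebraMap_apply, ← W.coe_algebraMap, map_mul, MulMemClass.coe_mul, map_mul]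
    exact mul_le_of_le_one_right zero_le (W.1.valuation_le_one _)
  -- A power of `ϖ` has its value in the base group, and `w(π)` is the largest base value below 1.
  -- The least such exponent will be the ramification index.
  have hex : ∃ e : ℕ, algebraMap V W.1 π ∣ ϖ ^ e := by
    obtain ⟨n, hn, c, hc⟩ := exists_pow_valuation_eq (K := K) W.1.valuation
      (y := (ϖ : L)) (by simpa using hϖ0)
    have := hbase c (hc ▸ pow_lt_one₀ zero_le hvlt hn)
    rw [← hc, ← map_pow] at this
    obtain ⟨u, hu⟩ := (W.1.valuation_le_iff _ _).1 this
    exact ⟨n, u, Subtype.ext (by rw [mul_comm]; exact hu.symm)⟩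
  classical
  obtain ⟨e, ⟨u, hu⟩, hmin⟩ : ∃ e : ℕ, algebraMap V W.1 π ∣ ϖ ^ e ∧
      ∀ m < e, ¬ algebraMap V W.1 π ∣ ϖ ^ m :=
    ⟨Nat.find hex, Nat.find_spec hex, fun m hm => Nat.find_min hex hm⟩
  have he0 : e ≠ 0 := by
    rintro rfl
    rw [pow_zero] at hu
    exact hπW (IsUnit.of_mul_eq_one u hu.symm)
  -- Otherwise `ϖ` divides `u`, and cancelling it gives `π ∣ ϖ ^ (e - 1)`.
  have huu : IsUnit u := by
    by_contra hnu
    have hum : u ∈ maximalIdeal W.1 := hnu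
    rw [hϖ, Ideal.mem_span_singleton] at hum
    obtain ⟨u', rfl⟩ := hum
    refine hmin (e - 1) (by omega) ⟨u', mul_left_cancel₀ hϖ0 ?_⟩
    rw [mul_pow_sub_one he0, hu]
    ring
  have hspan : (maximalIdeal V).map (algebraMap V W.1) = Ideal.span {ϖ ^ e} := by
    rw [hπ, Ideal.map_span, Set.image_singleton, hu, Ideal.span_singleton_mul_right_unit huu]
  have hvπ : W.1.valuation (algebraMap V W.1 π : W.1) = W.1.valuation (ϖ : L) ^ e := by
    rw [← map_pow, ← SubmonoidClass.coe_pow, hu, MulMemClass.coe_mul, map_mul,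
      (W.1.valuation_eq_one_iff u).1 huu, mul_one]
  -- With `w(y) ^ n = w(π ^ a * d ^ n)`, the `n`-th power of `w(y / d)` is `w(ϖ) ^ (e * a)`, so `w(y
  -- / d)` is itself a power of `w(ϖ)`.
  have hgen : ∀ y : L, y ≠ 0 → ∃ (d : K) (j : ℤ),
      W.1.valuation y = W.1.valuation (algebraMap K L d) * W.1.valuation (ϖ : L) ^ j := by
    intro y hy
    obtain ⟨n, hn, c, hc⟩ := exists_pow_valuation_eq (K := K) W.1.valuation hy
    have hvy : W.1.valuation y ≠ 0 := by simpa using hy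
    have hc0 : c ≠ 0 := by
      rintro rfl
      rw [map_zero, map_zero] at hc
      exact pow_ne_zero n hvy hc
    obtain ⟨a, d, had⟩ := h n hn c hc0
    have hd0 : d ≠ 0 := by
      rintro rfl
      rw [map_zero, zero_pow hn, mul_zero] at had
      exact hc0 (by simpa using had)
    rw [← map_zpow₀, ← map_pow, ← map_mul, W.isEquiv_comap.eq_iff, Valuation.comap_apply,
      Valuation.comap_apply, ← hc, map_mul, map_mul, map_zpow₀, map_zpow₀, map_pow, map_pow,
      ← IsScalarTower.algebraMap_apply, ← W.coe_algebraMap, hvπ, ← zpow_natCast _ e,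
      ← zpow_mul] at had
    have hvd : W.1.valuation (algebraMap K L d) ≠ 0 := by simpa using hd0
    obtain ⟨j, hj⟩ := exists_valuation_eq_zpow_of_pow_eq W.1 hϖ hϖ0 (z := y / algebraMap K L d) hn
      (b := e * a) (by rw [map_div₀, div_pow, had, mul_div_cancel_right₀ _ (pow_ne_zero n hvd)])
    refine ⟨d, j, ?_⟩
    rw [← hj, map_div₀, mul_div_cancel₀ _ hvd]
  -- The class of `w(ϖ)` generates the quotient by `hgen`. Its order is `e`, since for `0 < m < e`
  -- the value `w(ϖ) ^ m` lies strictly between `w(π)` and 1.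
  have hram : W.ramificationIndex = e := by
    let t : (W.1.ValueGroup)ˣ := Units.mk0 _ hv0
    have hord : orderOf (QuotientGroup.mk t : (W.1.ValueGroup)ˣ ⧸ W.baseValues) = e := by
      rw [orderOf_eq_iff (Nat.pos_of_ne_zero he0)]
      refine ⟨?_, fun m hm hm0 hone => ?_⟩
      · rw [← QuotientGroup.mk_pow, QuotientGroup.eq_one_iff, mem_baseValues]
        refine ⟨algebraMap V K π, ?_⟩
        rw [← IsScalarTower.algebraMap_apply, ← W.coe_algebraMap, hvπ]
        rfl
      · rw [← QuotientGroup.mk_pow, QuotientGroup.eq_one_iff, mem_baseValues] at hone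
        obtain ⟨c, hc⟩ := hone
        have hc' : W.1.valuation (algebraMap K L c) = W.1.valuation (ϖ : L) ^ m := hc
        have := hbase c (hc' ▸ pow_lt_one₀ zero_le hvlt hm0.ne')
        rw [hc', hvπ] at this
        exact this.not_gt (pow_lt_pow_right_of_lt_one₀ (zero_lt_iff.2 hv0) hvlt hm)
    have htop : Subgroup.zpowers (QuotientGroup.mk t : (W.1.ValueGroup)ˣ ⧸ W.baseValues) = ⊤ := by
      rw [eq_top_iff]
      intro q _
      obtain ⟨g, rfl⟩ := QuotientGroup.mk_surjective q
      obtain ⟨y, hy⟩ := W.1.valuation_surjective (g : W.1.ValueGroup)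
      have hy0 : y ≠ 0 := by
        rintro rfl
        rw [map_zero] at hy
        exact g.ne_zero hy.symm
      obtain ⟨d, j, hdj⟩ := hgen y hy0
      refine Subgroup.mem_zpowers_iff.2 ⟨j, ?_⟩
      rw [← QuotientGroup.mk_zpow, QuotientGroup.eq, mem_baseValues]
      refine ⟨d, ?_⟩
      rw [Units.val_mul, ← hy, hdj, ← zpow_neg, Units.val_zpow_eq_zpow_val, Units.val_mk0, zpow_neg,
        mul_comm, mul_assoc, mul_inv_cancel₀ (zpow_ne_zero _ hv0), mul_one]
    rw [ramificationIndex, Subgroup.index, ← hord, ← Nat.card_zpowers, htop]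
    exact Nat.card_congr (Equiv.Set.univ _).symm
  rw [hram, ← length_residueField, length_quotient_congr V hϖ]
  refine (congrArg ENat.toNat ((length_quotient_congr V hspan).trans
    (length_quotient_span_pow V hϖ0 e))).trans ?_
  rw [ENat.toNat_mul, ENat.toNat_natCast]

end Extension

end ValRing

/-! ### Ordered groups with a largest `n`-th part below each element -/

section OrderedGroup

variable {Γ : Type*} [AddCommGroup Γ] [LinearOrder Γ] [IsOrderedAddMonoid Γ]

/-- Split `ρ` into positive parts `η` and `ρ - η`, and apply induction to the smaller one. -/
theorem exists_nsmul_le_of_not_isLeast (h : ¬ ∃ ε, IsLeast {γ : Γ | 0 < γ} ε) (n : ℕ) :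
    ∀ ρ : Γ, 0 < ρ → ∃ η > 0, (n + 1) • η ≤ ρ := by
  induction n with
  | zero => exact fun ρ hρ => ⟨ρ, hρ, by simp⟩
  | succ n ih =>
    intro ρ hρ
    obtain ⟨η, hη, hηρ⟩ : ∃ η, 0 < η ∧ η < ρ := by
      by_contra! hcon
      exact h ⟨ρ, hρ, fun η hη => hcon η hη⟩
    obtain ⟨σ, hσ, hle⟩ := ih (min η (ρ - η)) (lt_min hη (sub_pos.2 hηρ))
    refine ⟨σ, hσ, ?_⟩
    have h1 : σ ≤ η := by
      refine le_trans ?_ (hle.trans (min_le_left _ _))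
      exact le_self_nsmul hσ.le (Nat.succ_ne_zero n)
    have h2 : (n + 1) • σ ≤ ρ - η := hle.trans (min_le_right _ _)
    rw [succ_nsmul]
    calc (n + 1) • σ + σ ≤ ρ - η + η := add_le_add h2 h1
      _ = ρ := sub_add_cancel _ _

theorem exists_eq_nsmul_of_lt_nsmul {ε : Γ} (hε : IsLeast {γ : Γ | 0 < γ} ε) (n : ℕ) :
    ∀ ρ : Γ, 0 ≤ ρ → ρ < n • ε → ∃ a : ℕ, ρ = a • ε := by
  induction n with
  | zero => exact fun ρ h0 h => absurd (by simpa using h) h0.not_gt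
  | succ n ih =>
    intro ρ h0 h
    by_cases hρ : ε ≤ ρ
    · obtain ⟨a, ha⟩ := ih (ρ - ε) (sub_nonneg.2 hρ) (by rwa [sub_lt_iff_lt_add, ← succ_nsmul])
      exact ⟨a + 1, by rw [succ_nsmul, ← ha, sub_add_cancel]⟩
    · refine ⟨0, ?_⟩
      rw [zero_nsmul]
      by_contra hne
      exact hρ (hε.2 (lt_of_le_of_ne h0 (Ne.symm hne)))

theorem nonempty_divisibleBy_iff {G : Type*} [AddCommGroup G] :
    Nonempty (DivisibleBy G ℕ) ↔ ∀ n : ℕ, n ≠ 0 → ∀ g : G, ∃ d : G, n • d = g :=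
  ⟨fun ⟨_⟩ n hn g => ⟨DivisibleBy.div g n, DivisibleBy.div_cancel g hn⟩,
    fun h => ⟨divisibleByOfSMulRightSurj G ℕ fun hn g => h _ hn g⟩⟩

theorem nonempty_divisibleBy_quotient_iff {G : Type*} [AddCommGroup G] {ε : G} :
    Nonempty (DivisibleBy (G ⧸ AddSubgroup.zmultiples ε) ℕ) ↔
      ∀ n : ℕ, n ≠ 0 → ∀ g : G, ∃ (a : ℤ) (d : G), g = a • ε + n • d := by
  rw [nonempty_divisibleBy_iff]
  refine forall₂_congr fun n _ => ?_
  constructor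
  · intro h g
    obtain ⟨q, hq⟩ := h (QuotientAddGroup.mk g)
    obtain ⟨d, rfl⟩ := QuotientAddGroup.mk_surjective q
    rw [← QuotientAddGroup.mk_nsmul, QuotientAddGroup.eq] at hq
    obtain ⟨a, ha⟩ := AddSubgroup.mem_zmultiples_iff.1 hq
    exact ⟨a, d, by rw [ha]; abel⟩
  · intro h q
    obtain ⟨g, rfl⟩ := QuotientAddGroup.mk_surjective q
    obtain ⟨a, d, rfl⟩ := h g
    refine ⟨QuotientAddGroup.mk d, ?_⟩
    rw [← QuotientAddGroup.mk_nsmul, QuotientAddGroup.eq]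
    exact AddSubgroup.mem_zmultiples_iff.2 ⟨a, by abel⟩

/-- By maximality no `η > 0` has `n • η` at most the remainder `γ - n • δ`. With a least positive
`ε` the remainder is below `n • ε`, hence a multiple of `ε`; without one it is zero. -/
theorem divisible_or_of_exists_max
    (h : ∀ n : ℕ, n ≠ 0 → ∀ γ : Γ, ∃ δ, n • δ ≤ γ ∧ ∀ δ', n • δ' ≤ γ → δ' ≤ δ) :
    Nonempty (DivisibleBy Γ ℕ) ∨ ∃ ε : Γ, IsLeast {γ : Γ | 0 < γ} ε ∧
      Nonempty (DivisibleBy (Γ ⧸ AddSubgroup.zmultiples ε) ℕ) := by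
  by_cases hε : ∃ ε, IsLeast {γ : Γ | 0 < γ} ε
  · obtain ⟨ε, hε⟩ := hε
    refine Or.inr ⟨ε, hε, nonempty_divisibleBy_quotient_iff.2 fun n hn γ => ?_⟩
    obtain ⟨δ, hδ, hmax⟩ := h n hn γ
    obtain ⟨a, ha⟩ := exists_eq_nsmul_of_lt_nsmul hε n (γ - n • δ) (sub_nonneg.2 hδ) <| by
      by_contra! hcon
      have := hmax (ε + δ) (by rwa [nsmul_add, ← le_sub_iff_add_le])
      exact this.not_gt (lt_add_of_pos_left δ hε.1)
    exact ⟨a, δ, by rw [natCast_zsmul, ← ha, sub_add_cancel]⟩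
  · refine Or.inl (nonempty_divisibleBy_iff.2 fun n hn γ => ?_)
    obtain ⟨δ, hδ, hmax⟩ := h n hn γ
    refine ⟨δ, hδ.eq_of_not_lt fun hlt => ?_⟩
    obtain ⟨η, hη, hle⟩ := exists_nsmul_le_of_not_isLeast hε (n - 1) _ (sub_pos.2 hlt)
    rw [Nat.sub_add_cancel (Nat.one_le_iff_ne_zero.2 hn)] at hle
    have := hmax (η + δ) (by rwa [nsmul_add, ← le_sub_iff_add_le])
    exact this.not_gt (lt_add_of_pos_left δ hη)

end OrderedGroup

/-! ### The additive valuation and integral multiples of an element -/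

namespace ValRing

theorem valuation_lt_one_iff_mem_maximalIdeal {V K : Type*} [CommRing V] [IsDomain V]
    [ValuationRing V] [Field K] [Algebra V K] [IsFractionRing V K] {a : V} :
    ValuationRing.valuation V K (algebraMap V K a) < 1 ↔ a ∈ maximalIdeal V := by
  rw [mem_maximalIdeal, mem_nonunits_iff, lt_iff_not_ge, not_iff_not]
  constructor
  · intro h
    have h0 : algebraMap V K a ≠ 0 := by
      intro h0
      rw [h0, map_zero] at h
      exact h.not_gt zero_lt_one
    obtain ⟨b, hb⟩ : (algebraMap V K a)⁻¹ ∈ (algebraMap V K).range := by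
      rw [← valuation_le_one_iff_mem_range, map_inv₀]
      exact inv_le_one_of_one_le₀ h
    refine IsUnit.of_mul_eq_one b (IsFractionRing.injective V K ?_)
    rw [map_mul, hb, map_one, mul_inv_cancel₀ h0]
  · rintro ⟨u, rfl⟩
    have h := (valuation_le_one_iff_mem_range (V := V) (algebraMap V K ↑u⁻¹)).2 ⟨_, rfl⟩
    have h1 : ValuationRing.valuation V K (algebraMap V K u) *
        ValuationRing.valuation V K (algebraMap V K ↑u⁻¹) = 1 := by
      rw [← map_mul, ← map_mul, Units.mul_inv, map_one, map_one]
    exact h1.symm.le.trans (mul_le_of_le_one_right zero_le h)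

section AddValuation

variable (V : Type*) [CommRing V] [IsDomain V] [ValuationRing V]

/-- The additive valuation of `V` on the nonzero elements of its fraction field. -/
noncomputable def addVal : Additive (FractionRing V)ˣ →+ AddValueGroup V :=
  AddMonoidHom.mk' (fun x => OrderDual.toDual (Additive.ofMul
    (Units.map (ValuationRing.valuation V (FractionRing V)).toMonoidWithZeroHom.toMonoidHom
      x.toMul))) fun _ _ => by rw [toMul_add, map_mul]; rfl

variable {V}

theorem addVal_le_iff {x y : (FractionRing V)ˣ} :
    addVal V (.ofMul x) ≤ addVal V (.ofMul y) ↔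
      ValuationRing.valuation V (FractionRing V) y ≤ ValuationRing.valuation V (FractionRing V) x :=
  Iff.rfl

theorem addVal_eq_iff {x y : (FractionRing V)ˣ} :
    addVal V (.ofMul x) = addVal V (.ofMul y) ↔
      ValuationRing.valuation V (FractionRing V) x = ValuationRing.valuation V (FractionRing V) y := by
  rw [le_antisymm_iff, le_antisymm_iff, addVal_le_iff, addVal_le_iff, and_comm]

theorem addVal_surjective (γ : AddValueGroup V) :
    ∃ x : (FractionRing V)ˣ, addVal V (.ofMul x) = γ := by
  obtain ⟨y, hy⟩ : ∃ y, ValuationRing.valuation V (FractionRing V) y =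
      ((OrderDual.ofDual γ).toMul : ValuationRing.ValueGroup V (FractionRing V)) :=
    Quotient.mk''_surjective _
  have hy0 : y ≠ 0 := by
    rintro rfl
    rw [map_zero] at hy
    exact Units.ne_zero _ hy.symm
  refine ⟨Units.mk0 y hy0, ?_⟩
  change OrderDual.toDual (Additive.ofMul _) = OrderDual.toDual (Additive.ofMul _)
  congr 2
  exact Units.ext hy

end AddValuation

section ExistsMax

variable {V K L : Type*} [CommRing V] [IsDomain V] [ValuationRing V] [Field K]
  [Algebra V K] [IsFractionRing V K] [Field L] [Algebra K L] [Algebra V L] [IsScalarTower V K L]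
  [FiniteDimensional K L]

theorem isIntegral_smul_iff {ι : Type*} [Finite ι] (b : Module.Basis ι V (integralClosure V L))
    (α : L) (c : K) : IsIntegral V (c • α) ↔
      ∀ i, c * (basisOfIntegralClosure (K := K) b).repr α i ∈ (algebraMap V K).range := by
  have := Fintype.ofFinite ι
  constructor
  · intro h i
    have hloc := IsIntegralClosure.isLocalization V K L (integralClosure V L)
    refine ⟨b.repr ⟨c • α, h⟩ i, ?_⟩
    have := Module.Basis.localizationLocalization_repr_algebraMap K (nonZeroDivisors V) L b
      ⟨c • α, h⟩ i
    rw [← this]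
    change (basisOfIntegralClosure (K := K) b).repr (c • α) i = _
    rw [map_smul, Finsupp.smul_apply, smul_eq_mul]
  · intro h
    choose a ha using h
    have : c • α = ((∑ i, a i • b i : integralClosure V L) : L) := by
      conv_lhs => rw [← (basisOfIntegralClosure (K := K) b).sum_repr α]
      rw [AddSubmonoidClass.coe_finsetSum, Finset.smul_sum]
      refine Finset.sum_congr rfl fun i _ => ?_
      rw [Subalgebra.coe_smul, ← IsScalarTower.algebraMap_smul K (a i) (b i : L), ha, smul_smul,
        basisOfIntegralClosure_apply]
    rw [this]
    exact Subtype.property _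

/-- In coordinates `r i` of `α` over a `V`-basis of `B`, integrality of `c • α` means that all `c *
r i` lie in `V`. The coordinate `r j` of largest valuation decides this, and `d = (r j)⁻¹`. -/
theorem exists_generator_smul_integral [Module.Finite V (integralClosure V L)] {α : L}
    (hα : α ≠ 0) : ∃ d : K, d ≠ 0 ∧ IsIntegral V (d • α) ∧ ∀ c : K, IsIntegral V (c • α) →
      ValuationRing.valuation V K c ≤ ValuationRing.valuation V K d := by
  have := isTorsionFree_of_isFractionRing V K L
  have := free_integralClosure V L
  let b := Module.Free.chooseBasis V (integralClosure V L)
  let r := (basisOfIntegralClosure (K := K) b).repr α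
  obtain ⟨i, hi⟩ : ∃ i, r i ≠ 0 := by
    by_contra! h
    have hr : r = 0 := Finsupp.ext h
    exact hα ((LinearEquiv.map_eq_zero_iff _).1 hr)
  obtain ⟨j, -, hmax⟩ := Finset.univ.exists_max_image (fun i => ValuationRing.valuation V K (r i))
    ⟨i, Finset.mem_univ i⟩
  have hj : r j ≠ 0 := by
    intro h0
    have := hmax i (Finset.mem_univ i)
    rw [h0, map_zero, le_zero_iff, map_eq_zero] at this
    exact hi this
  have hvj : ValuationRing.valuation V K (r j) ≠ 0 := by simpa using hj
  refine ⟨(r j)⁻¹, inv_ne_zero hj, (isIntegral_smul_iff b α _).2 fun i => ?_, fun c hc => ?_⟩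
  · rw [← valuation_le_one_iff_mem_range, mul_comm, ← div_eq_mul_inv, map_div₀]
    exact div_le_one_of_le₀ (hmax i (Finset.mem_univ i)) zero_le
  · have := (isIntegral_smul_iff b α c).1 hc j
    rw [← valuation_le_one_iff_mem_range, map_mul] at this
    rw [map_inv₀, ← one_div]
    exact (le_div_iff₀ (zero_lt_iff.2 hvj)).2 this

theorem isIntegral_smul_iff_of_pow_eq {α : L} {x : K} {n : ℕ} (hn : n ≠ 0)
    (hα : α ^ n = algebraMap K L x) (c : K) :
    IsIntegral V (c • α) ↔ ValuationRing.valuation V K (c ^ n * x) ≤ 1 := by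
  have h : IsIntegral V (c • α) ↔ IsIntegral V (algebraMap K L (c ^ n * x)) := by
    rw [map_mul, map_pow, ← hα, ← mul_pow, ← Algebra.smul_def]
    exact ⟨fun h => h.pow n, fun h => IsIntegral.of_pow (Nat.pos_of_ne_zero hn) h⟩
  rw [h, isIntegral_algebraMap_iff (algebraMap K L).injective, IsIntegrallyClosed.isIntegral_iff,
    valuation_le_one_iff_mem_range]
  rfl

end ExistsMax

end ValRing

/-! ### Condition (ii) and the equivalence -/

section ValueGroup

open ValRing

variable {V : Type u} [CommRing V] [IsDomain V] [ValuationRing V]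

theorem exists_finiteDimensional_pow_eq {K : Type u} [Field K] (x : K) {n : ℕ} (hn : n ≠ 0) :
    ∃ (L : Type u) (_ : Field L) (_ : Algebra K L) (_ : FiniteDimensional K L) (α : L),
      α ^ n = algebraMap K L x := by
  let p : Polynomial K := Polynomial.X ^ n - Polynomial.C x
  have hdeg : (p.map (algebraMap K p.SplittingField)).degree ≠ 0 := by
    rw [Polynomial.degree_map, Polynomial.degree_X_pow_sub_C (Nat.pos_of_ne_zero hn)]
    exact_mod_cast hn
  obtain ⟨α, hα⟩ := (Polynomial.SplittingField.splits p).exists_eval_eq_zero hdeg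
  exact ⟨p.SplittingField, inferInstance, inferInstance, inferInstance, α,
    by simpa [p, sub_eq_zero] using hα⟩

/-- For `α ^ n = x`, integrality of `c • α` means `n • δ ≤ v(x)` with `δ = -v(c)`. The generator `d`
of the integral multiples thus gives the largest `δ`. -/
theorem IsN2.divisible_or (h : IsN2 V) :
    Nonempty (DivisibleBy (AddValueGroup V) ℕ) ∨
      ∃ ε : AddValueGroup V, IsLeast {γ : AddValueGroup V | 0 < γ} ε ∧
        Nonempty (DivisibleBy (AddValueGroup V ⧸ AddSubgroup.zmultiples ε) ℕ) := by
  refine divisible_or_of_exists_max fun n hn γ => ?_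
  obtain ⟨x, rfl⟩ := addVal_surjective γ
  obtain ⟨L, _, _, _, α, hα⟩ := exists_finiteDimensional_pow_eq (x : FractionRing V) hn
  let _ : Algebra V L := ((algebraMap (FractionRing V) L).comp (algebraMap V _)).toAlgebra
  have : IsScalarTower V (FractionRing V) L := IsScalarTower.of_algebraMap_eq fun _ => rfl
  have : Module.Finite V (integralClosure V L) := h L
  have hα0 : α ≠ 0 := by
    rintro rfl
    rw [zero_pow hn] at hα
    exact x.ne_zero (by simpa using hα.symm)
  obtain ⟨d, hd0, hd, hmax⟩ := exists_generator_smul_integral (V := V) (K := FractionRing V) hα0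
  have key : ∀ c : (FractionRing V)ˣ, n • addVal V (.ofMul c⁻¹) ≤ addVal V (.ofMul x) ↔
      IsIntegral V ((c : FractionRing V) • α) := by
    intro c
    have hc : 0 < ValuationRing.valuation V (FractionRing V) ((c : FractionRing V) ^ n) :=
      zero_lt_iff.2 (by simp)
    rw [isIntegral_smul_iff_of_pow_eq hn hα, ← map_nsmul, ← ofMul_pow, addVal_le_iff, map_mul,
      inv_pow, Units.val_inv_eq_inv_val, map_inv₀, Units.val_pow_eq_pow_val, mul_comm,
      ← one_div, le_div_iff₀ hc]
  refine ⟨addVal V (.ofMul (Units.mk0 d hd0)⁻¹), (key _).2 hd, fun δ hδ => ?_⟩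
  obtain ⟨c, rfl⟩ : ∃ c, addVal V (.ofMul c⁻¹) = δ := by
    obtain ⟨c, rfl⟩ := addVal_surjective δ
    exact ⟨c⁻¹, by rw [inv_inv]⟩
  rw [ofMul_inv, ofMul_inv, map_neg, map_neg, neg_le_neg_iff, addVal_le_iff]
  exact hmax _ ((key c).1 hδ)

theorem exists_valuation_eq_pow (h : Nonempty (DivisibleBy (AddValueGroup V) ℕ)) (n : ℕ)
    (hn : n ≠ 0) (x : FractionRing V) (hx : x ≠ 0) :
    ∃ d : FractionRing V, ValuationRing.valuation V (FractionRing V) x =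
      ValuationRing.valuation V (FractionRing V) d ^ n := by
  obtain ⟨δ, hδ⟩ := nonempty_divisibleBy_iff.1 h n hn (addVal V (.ofMul (Units.mk0 x hx)))
  obtain ⟨d, rfl⟩ := addVal_surjective δ
  rw [← map_nsmul, ← ofMul_pow, addVal_eq_iff, Units.val_pow_eq_pow_val, map_pow] at hδ
  exact ⟨d, hδ.symm⟩

theorem exists_uniformizer {ε : AddValueGroup V} (hε : IsLeast {γ : AddValueGroup V | 0 < γ} ε) :
    ∃ (p : (FractionRing V)ˣ) (π : V), addVal V (.ofMul p) = ε ∧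
      algebraMap V _ π = (p : FractionRing V) ∧ maximalIdeal V = Ideal.span {π} := by
  obtain ⟨p, rfl⟩ := addVal_surjective ε
  have hpos : ∀ x : (FractionRing V)ˣ, 0 < addVal V (.ofMul x) ↔
      ValuationRing.valuation V (FractionRing V) x < 1 := by
    intro x
    rw [← map_zero (addVal V), ← ofMul_one, lt_iff_not_ge, addVal_le_iff, Units.val_one, map_one,
      not_le]
  have hp := (hpos p).1 hε.1
  obtain ⟨π, hπ⟩ := (valuation_le_one_iff_mem_range _).1 hp.le
  refine ⟨p, π, rfl, hπ, le_antisymm (fun a ha => ?_) ?_⟩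
  · rw [Ideal.mem_span_singleton]
    by_cases ha0 : a = 0
    · exact ha0 ▸ dvd_zero π
    · have ha0' : algebraMap V (FractionRing V) a ≠ 0 := by simpa using ha0
      have hlt : ValuationRing.valuation V (FractionRing V) (algebraMap V _ a) < 1 :=
        valuation_lt_one_iff_mem_maximalIdeal.2 ha
      obtain ⟨c, hc⟩ := addVal_le_iff.1 (hε.2 ((hpos (Units.mk0 _ ha0')).2 hlt))
      refine ⟨c, IsFractionRing.injective V (FractionRing V) ?_⟩
      rw [mul_comm, map_mul, ← Algebra.smul_def, hπ]
      exact hc.symm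
  · rw [Ideal.span_singleton_le_iff_mem,
      ← valuation_lt_one_iff_mem_maximalIdeal (K := FractionRing V), hπ]
    exact hp

theorem exists_valuation_eq_zpow_mul_pow {p : (FractionRing V)ˣ}
    (h : Nonempty (DivisibleBy
      (AddValueGroup V ⧸ AddSubgroup.zmultiples (addVal V (.ofMul p))) ℕ)) (n : ℕ)
    (hn : n ≠ 0) (x : FractionRing V) (hx : x ≠ 0) :
    ∃ (a : ℤ) (d : FractionRing V), ValuationRing.valuation V (FractionRing V) x =
      ValuationRing.valuation V (FractionRing V) p ^ a *
        ValuationRing.valuation V (FractionRing V) d ^ n := by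
  obtain ⟨a, δ, h⟩ := nonempty_divisibleBy_quotient_iff.1 h n hn
    (addVal V (.ofMul (Units.mk0 x hx)))
  obtain ⟨d, rfl⟩ := addVal_surjective δ
  rw [← map_nsmul, ← map_zsmul, ← map_add, ← ofMul_pow, ← ofMul_zpow, ← ofMul_mul, addVal_eq_iff,
    Units.val_mul, Units.val_pow_eq_pow_val, Units.val_zpow_eq_zpow_val, map_mul, map_pow,
    map_zpow₀] at h
  exact ⟨a, d, h⟩

/-- Both sides compare `[L:K]` with a sum over the extensions, of the `e * f` or of the lengths of
the `W/mW`; condition (ii) makes the sums agree term by term. -/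
theorem isDefectlessExtension_iff
    (h : Nonempty (DivisibleBy (AddValueGroup V) ℕ) ∨
      ∃ ε : AddValueGroup V, IsLeast {γ : AddValueGroup V | 0 < γ} ε ∧
        Nonempty (DivisibleBy (AddValueGroup V ⧸ AddSubgroup.zmultiples ε) ℕ))
    (L : Type*) [Field L] [Algebra (FractionRing V) L] [FiniteDimensional (FractionRing V) L]
    [Algebra V L] [IsScalarTower V (FractionRing V) L] :
    IsDefectlessExtension V (FractionRing V) L ↔ Module.Finite V (integralClosure V L) := by
  have key : ∀ W : Extension V (FractionRing V) L,
      (Module.length V W.Reduction).toNat = W.ramificationIndex * W.inertiaDegree := by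
    intro W
    obtain h | ⟨ε, hε, h⟩ := h
    · exact W.length_reduction_of_divisible (exists_valuation_eq_pow h)
    · obtain ⟨p, π, rfl, hπ, hm⟩ := exists_uniformizer hε
      refine W.length_reduction_of_discrete ?_ hm ?_
      · rintro rfl
        rw [map_zero] at hπ
        exact p.ne_zero hπ.symm
      · rw [hπ]
        exact exists_valuation_eq_zpow_mul_pow h
  rw [finite_integralClosure_iff (K := FractionRing V),
    Extension.finrank_reducedClosure V (FractionRing V) L, IsDefectlessExtension, eq_comm, finsum_congr key]

end ValueGroup

theorem lemma2p6 (V : Type u) [CommRing V] [IsDomain V] [ValuationRing V] :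
    IsN2 V ↔
      ValRing.IsDefectless V ∧
        (Nonempty (DivisibleBy (ValRing.AddValueGroup V) ℕ) ∨
          ∃ ε : ValRing.AddValueGroup V, IsLeast {γ : ValRing.AddValueGroup V | 0 < γ} ε ∧
            Nonempty (DivisibleBy (ValRing.AddValueGroup V ⧸ AddSubgroup.zmultiples ε) ℕ)) := by
  constructor
  · refine fun h => ⟨fun L _ _ _ => ?_, h.divisible_or⟩
    let _ : Algebra V L := ((algebraMap (FractionRing V) L).comp (algebraMap V _)).toAlgebra
    have : IsScalarTower V (FractionRing V) L := IsScalarTower.of_algebraMap_eq fun _ => rfl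
    exact (isDefectlessExtension_iff h.divisible_or L).2 (h L)
  · exact fun ⟨h, hΓ⟩ L _ _ _ _ _ => (isDefectlessExtension_iff hΓ L).1 (h L)
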